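/- Let $N$ be an infinite (that is, type III) von Neumann factor on a separable Hilbert space. Homomorphisms are unital $*$-homomorphisms; for homomorphisms $\alpha,\beta:N\to M$, $\mathrm{Hom}(\alpha,\beta)=\{t\in M:\ t\alpha(n)=\beta(n)t\ \ \forall n\in N\}$, composed by the product of $M$, and $\beta\prec\alpha$ means that $\mathrm{Hom}(\beta,\alpha)$ contains an isometry. A solution of the conjugacy relations for $\alpha:N\to M$ and $\bar\alpha:M\to N$ is a pair $w\in\mathrm{Hom}(\mathrm{id}_N,\bar\alpha\alpha)$, $\bar w\in\mathrm{Hom}(\mathrm{id}_M,\alpha\bar\alpha)$ with $w^*\bar\alpha(\bar w)=1$ and $\alpha(w^*)\bar w=1$; $\dim(\alpha)$ is the infimum of the numbers $d$ for which there are $\bar\alpha$ and a solution with $w^*w=d\cdot 1$, $\bar w^*\bar w=d\cdot 1$, and a solution is standard if it attains this infimum. Let $\mathcal C\subset\mathrm{End}_0(N)$ be a full subcategory of the category of finite-dimensional endomorphisms of $N$ that contains $\mathrm{id}_N$, is closed under composition and subobjects ($\sigma\prec\rho\in\mathcal C$ implies $\sigma\in\mathcal C$), and has direct sums. Let $\mathbf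 A=(\theta,w,x)$ be a Q-system in $\mathcal C$, i.e. $\theta\in\mathcal C$, $w\in\mathrm{Hom}(\mathrm{id}_N,\theta)$, $x\in\mathrm{Hom}(\theta,\theta^2)$ with $$w^*x=\theta(w^*)x=1,\quad x^2=\theta(x)x,\quad \theta(x^*)x=xx^*=x^*\theta(x),\quad w^*w=x^*x=\sqrt{\dim\theta}\cdot 1.$$ Let $M$ (a von Neumann algebra on a separable Hilbert space), $\iota:N\to M$ and $\bar\iota:M\to N$ be the corresponding extension: $\theta=\bar\iota\iota$, and there is $v\in M$ with $x=\bar\iota(v)$ such that $(w,v)$ is a standard solution of the conjugacy relations for $(\iota,\bar\iota)$. Assume that $\mathbf A$ is simple, i.e. that $M$ is a factor. A module of $\mathbf A$ is a pair $(\beta,m)$ with $\beta$ an endomorphism and $m\in\mathrm{Hom}(\beta,\theta\beta)$ such that $w^*m=1$ and $\theta(m)m=xm$; it is standard if $m^*m$ is a multiple of $1$. A morphism $(\beta,m)\to(\beta',m')$ is a $t\in\mathrm{Hom}(\beta,\beta')$ with $\theta(t)m=m't$. The module category of $\mathbf A$ in $\mathcal C$ consists of all modules $(\beta,m)$ with $\beta\in\mathcal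 C$ and their morphisms. Then: 1. For every homomorphism $\varphi:N\to M$, $(\bar\iota\varphi,x)$ is a standard module. For homomorphisms $\varphi,\varphi':N\to M$, the morphisms $(\bar\iota\varphi,x)\to(\bar\iota\varphi',x)$ are exactly the elements $1_{\bar\iota}\times s=\bar\iota(s)$ with $s\in\mathrm{Hom}(\varphi,\varphi')$. 2. The assignment $\varphi\mapsto(\bar\iota\varphi,x)$, $s\mapsto\bar\iota(s)$ is an equivalence of categories from the full subcategory of $\mathrm{Hom}(N,M)$ whose objects are the homomorphisms $\varphi:N\to M$ with $\varphi\prec\iota\rho$ for some $\rho\in\mathcal C$, onto the module category of $\mathbf A$ in $\mathcal C$. -/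

import Mathlib

open CategoryTheory

/-! ### Factors -/

/-- A factor: a nonzero von Neumann algebra whose centre `N ∩ N'` consists of the scalars. -/
structure VonNeumannAlgebra.IsFactor {H : Type*} [NormedAddCommGroup H] [InnerProductSpace ℂ H]
    [CompleteSpace H] (N : VonNeumannAlgebra H) : Prop where
  nontrivial : Nontrivial H
  center : ∀ z : H →L[ℂ] H, z ∈ N → z ∈ N.commutant → ∃ c : ℂ, z = c • (1 : H →L[ℂ] H)

/-- An infinite (= purely infinite, type III) factor: every nonzero projection `e` of `N` is
Murray-von Neumann equivalent in `N` to a proper subprojection of itself. -/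
structure VonNeumannAlgebra.IsInfiniteFactor {H : Type*} [NormedAddCommGroup H]
    [InnerProductSpace ℂ H] [CompleteSpace H] (N : VonNeumannAlgebra H) : Prop
    extends N.IsFactor where
  infinite : ∀ e : H →L[ℂ] H, e ∈ N → IsStarProjection e → e ≠ 0 →
    ∃ u : H →L[ℂ] H, u ∈ N ∧ star u * u = e ∧ e * (u * star u) = u * star u ∧ u * star u ≠ e

/-- The elements of a von Neumann algebra, as a `*`-algebra. -/
abbrev VonNeumannAlgebra.Elt {H : Type*} [NormedAddCommGroup H] [InnerProductSpace ℂ H]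
    [CompleteSpace H] (N : VonNeumannAlgebra H) : Type _ := ↥N.toStarSubalgebra

/-! ### Homomorphisms, intertwiners, conjugates, dimension

Homomorphisms are unital `*`-homomorphisms `A →⋆ₐ[ℂ] B`; the composite `β ∘ α` is `β.comp α`.
As operators, the monoidal products with identities are `t × 1_α = t` and `1_α × t = α t`, and
the composition `s ∘ t` of intertwiners is the product `s * t`. -/

section Intertwiners

variable {A B : Type*} [Ring A] [StarRing A] [Algebra ℂ A] [Ring B] [StarRing B] [Algebra ℂ B]

/-- `t ∈ Hom(α, β)`. -/
def IsIntertwiner (α β : A →⋆ₐ[ℂ] B) (t : B) : Prop :=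
  ∀ n : A, t * α n = β n * t

/-- `β ≺ α`: there is an isometry in `Hom(β, α)`. -/
def IsSubHom (β α : A →⋆ₐ[ℂ] B) : Prop :=
  ∃ s : B, IsIntertwiner β α s ∧ star s * s = 1

/-- `(w, w')` solves the conjugacy relations for `α : A → B` and `α' : B → A`. -/
structure IsConjugatePair (α : A →⋆ₐ[ℂ] B) (α' : B →⋆ₐ[ℂ] A) (w : A) (w' : B) : Prop where
  w_mem : IsIntertwiner (StarAlgHom.id ℂ A) (α'.comp α) w
  w'_mem : IsIntertwiner (StarAlgHom.id ℂ B) (α.comp α') w'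
  left : star w * α' w' = 1
  right : α (star w) * w' = 1

/-- The numbers `d` for which some conjugate of `α` has a solution `(w, w')` of the conjugacy
relations with `w* w = d` and `w'* w' = d`. -/
def dimSet (α : A →⋆ₐ[ℂ] B) : Set ℝ :=
  {d | ∃ (α' : B →⋆ₐ[ℂ] A) (w : A) (w' : B), IsConjugatePair α α' w w' ∧
    star w * w = (d : ℂ) • (1 : A) ∧ star w' * w' = (d : ℂ) • (1 : B)}

/-- `dim α < ∞`. -/
def HasFiniteDim (α : A →⋆ₐ[ℂ] B) : Prop := (dimSet α).Nonempty

/-- The dimension of `α` (meaningful if `HasFiniteDim α`). -/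
noncomputable def homDim (α : A →⋆ₐ[ℂ] B) : ℝ := sInf (dimSet α)

/-- A standard solution of the conjugacy relations: one that attains the infimum. -/
structure IsStandardPair (α : A →⋆ₐ[ℂ] B) (α' : B →⋆ₐ[ℂ] A) (w : A) (w' : B) : Prop
    extends IsConjugatePair α α' w w' where
  norm_w : star w * w = (homDim α : ℂ) • (1 : A)
  norm_w' : star w' * w' = (homDim α : ℂ) • (1 : B)

end Intertwiners

/-- The objects of the category `Hom(A, B)`. -/
structure HomCat (A B : Type*) [Ring A] [StarRing A] [Algebra ℂ A] [Ring B] [StarRing B]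
    [Algebra ℂ B] where
  toHom : A →⋆ₐ[ℂ] B

/-- The category `Hom(A, B)`: homomorphisms `A → B` and their intertwiners. -/
instance HomCat.category (A B : Type*) [Ring A] [StarRing A] [Algebra ℂ A] [Ring B] [StarRing B]
    [Algebra ℂ B] : Category (HomCat A B) where
  Hom φ ψ := {s : B // IsIntertwiner φ.toHom ψ.toHom s}
  id _ := ⟨1, fun n => by simp⟩
  comp {φ ψ χ} s t := ⟨t.1 * s.1, fun n => by
    rw [mul_assoc, s.2 n, ← mul_assoc, t.2 n, mul_assoc]⟩
  id_comp s := Subtype.ext (mul_one s.1)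
  comp_id s := Subtype.ext (one_mul s.1)
  assoc s t u := Subtype.ext (mul_assoc u.1 t.1 s.1).symm

/-! ### Q-systems and their modules -/

section QSystems

variable {A : Type*} [Ring A] [StarRing A] [Algebra ℂ A]

/-- `C` is the set of objects of a full tensor subcategory of `End₀(A)` with subobjects and
direct sums. -/
structure IsTensorSubcategory (C : Set (A →⋆ₐ[ℂ] A)) : Prop where
  finiteDim : ∀ ρ ∈ C, HasFiniteDim ρ
  id_mem : StarAlgHom.id ℂ A ∈ C
  comp_mem : ∀ ρ ∈ C, ∀ σ ∈ C, ρ.comp σ ∈ C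
  sub_mem : ∀ ρ ∈ C, ∀ σ : A →⋆ₐ[ℂ] A, IsSubHom σ ρ → σ ∈ C
  directSum : ∀ ρ₁ ∈ C, ∀ ρ₂ ∈ C, ∃ ρ ∈ C, ∃ s₁ s₂ : A,
    IsIntertwiner ρ₁ ρ s₁ ∧ IsIntertwiner ρ₂ ρ s₂ ∧
    star s₁ * s₁ = 1 ∧ star s₂ * s₂ = 1 ∧ star s₁ * s₂ = 0 ∧ s₁ * star s₁ + s₂ * star s₂ = 1

/-- A Q-system `(θ, w, x)` in `C`: a standard C* Frobenius algebra. -/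
structure QSystem (C : Set (A →⋆ₐ[ℂ] A)) where
  θ : A →⋆ₐ[ℂ] A
  w : A
  x : A
  θ_mem : θ ∈ C
  w_mem : IsIntertwiner (StarAlgHom.id ℂ A) θ w
  x_mem : IsIntertwiner θ (θ.comp θ) x
  unit_left : star w * x = 1
  unit_right : θ (star w) * x = 1
  associativity : x * x = θ x * x
  frobenius_left : θ (star x) * x = x * star x
  frobenius_right : x * star x = star x * θ x
  standard_w : star w * w = (√(homDim θ) : ℂ) • (1 : A)
  standard_x : star x * x = (√(homDim θ) : ℂ) • (1 : A)

namespace QSystem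

variable {C : Set (A →⋆ₐ[ℂ] A)} (Q : QSystem C)

/-- `(M, ι)` is the extension of `A` described by the Q-system `Q`: there is a conjugate `ι'` of
`ι` with `ι' ∘ ι = θ`, and a standard solution `(w, v)` of the conjugacy relations with
`ι' v = x`. -/
structure Extension (M : Type*) [Ring M] [StarRing M] [Algebra ℂ M] where
  ι : A →⋆ₐ[ℂ] M
  ι' : M →⋆ₐ[ℂ] A
  v : M
  comp_eq : ι'.comp ι = Q.θ
  standard : IsStandardPair ι ι' Q.w v
  map_v : ι' v = Q.x

/-- The defining relations of a (left) module `(β, m)` of `Q`. -/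
structure IsModule (β : A →⋆ₐ[ℂ] A) (m : A) : Prop where
  m_mem : IsIntertwiner β (Q.θ.comp β) m
  unit : star Q.w * m = 1
  repr : Q.θ m * m = Q.x * m

/-- A standard module: `m* m` is a multiple of `1`. -/
structure IsStandardModule (β : A →⋆ₐ[ℂ] A) (m : A) : Prop extends Q.IsModule β m where
  standard : ∃ c : ℂ, star m * m = c • (1 : A)

/-- `t` is a morphism of modules `(β, m) → (β', m')`. -/
structure IsModuleHom (β : A →⋆ₐ[ℂ] A) (m : A) (β' : A →⋆ₐ[ℂ] A) (m' : A) (t : A) : Prop where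
  intertwines : IsIntertwiner β β' t
  comm : Q.θ t * m = m' * t

/-- The objects of the module category of the Q-system `Q` in `C`. -/
structure Mod where
  β : A →⋆ₐ[ℂ] A
  m : A
  β_mem : β ∈ C
  isModule : Q.IsModule β m

/-- The module category of `Q`. -/
instance modCategory : Category Q.Mod where
  Hom X Y := {t : A // Q.IsModuleHom X.β X.m Y.β Y.m t}
  id X := ⟨1, fun n => by simp, by simp⟩
  comp {X Y Z} s t := ⟨t.1 * s.1, fun n => by
      rw [mul_assoc, s.2.1 n, ← mul_assoc, t.2.1 n, mul_assoc],
    by rw [map_mul, mul_assoc, s.2.2, ← mul_assoc, t.2.2, mul_assoc]⟩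
  id_comp s := Subtype.ext (mul_one s.1)
  comp_id s := Subtype.ext (one_mul s.1)
  assoc s t u := Subtype.ext (mul_assoc u.1 t.1 s.1).symm

/-- The homomorphisms `φ ≺ ι ∘ ρ` with `ρ ∈ C`, as a property of objects of `Hom(A, M)`. -/
def Extension.subHoms {M : Type*} [Ring M] [StarRing M] [Algebra ℂ M]
    {Q : QSystem C} (E : Q.Extension M) : ObjectProperty (HomCat A M) :=
  fun φ => ∃ ρ ∈ C, IsSubHom φ.toHom (E.ι.comp ρ)

end QSystem

end QSystems

/-! ### Projections in factors on separable Hilbert spaces -/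

namespace VonNeumannAlgebra

variable {H : Type*} [NormedAddCommGroup H] [InnerProductSpace ℂ H] [CompleteSpace H]

/-! The functor is faithful because `ι'` is injective. It is full because the right unit law
recovers any module morphism as `t = θ(w*)θ(t)x = ι'(ι(w*)ι(t)v)`, which lies in `ι'(M)`
(`isModuleHom_iff`).

For essential surjectivity, let `(β, m)` be a module and `d² = dim θ`. By the Frobenius relation, `e
= d⁻¹ v* ι(m)` is an idempotent of `M` commuting with `ιβ(N)`. Moreover `m` and `w*` restrict to
mutually inverse maps between `β` and the range of `ι'(e)`. If the range of `e` is that of an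
isometry `V`, then `φ = V* ιβ(·) V` is a homomorphism with `φ ≺ ιβ`, and `w* ι'(V)` is an
isomorphism `(ι'φ, x) → (β, m)`, with inverse `ι'(V*) m` (`exists_iso_of_isometry`).

To find `V`, replace `e`, which need not be self-adjoint as `m` need not be standard, by its range
projection `p`. A non-unitary isometry of `N` supplies infinitely many equivalent orthogonal nonzero
projections below `p`. In a factor on a separable space these make room below `p` for the range of
an isometry (`IsFactor.exists_isometry`), and a Schröder–Bernstein argument turns that range into
`p` itself (`exists_isometry_range_eq`). -/

theorem mem_of_forall_commutant {M : VonNeumannAlgebra H} {a : H →L[ℂ] H}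
    (h : ∀ c ∈ M.commutant, c * a = a * c) : a ∈ M := by
  rw [← M.commutant_commutant]
  exact mem_commutant_iff.2 h

theorem commute_of_mem_commutant {M : VonNeumannAlgebra H} {a c : H →L[ℂ] H}
    (ha : a ∈ M) (hc : c ∈ M.commutant) : c * a = a * c :=
  (mem_commutant_iff.1 hc a ha).symm

theorem smul_mem' {M : VonNeumannAlgebra H} {a : H →L[ℂ] H} (r : ℂ) (ha : a ∈ M) : r • a ∈ M :=
  M.toStarSubalgebra.smul_mem ha r

/-- The projection onto a closed subspace invariant under the commutant lies in the algebra. -/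
theorem starProjection_mem {M : VonNeumannAlgebra H} (S : Submodule ℂ H)
    [S.HasOrthogonalProjection] (h : ∀ c ∈ M.commutant, ∀ ξ ∈ S, c ξ ∈ S) :
    S.starProjection ∈ M := by
  rw [IsStarProjection.mem_iff isStarProjection_starProjection]
  intro c hc
  simpa [Module.End.mem_invtSubmodule, SetLike.le_def] using h c hc

theorem isClosed (M : VonNeumannAlgebra H) : IsClosed (M : Set (H →L[ℂ] H)) := by
  rw [← M.centralizer_centralizer]
  exact Set.isClosed_centralizer _

/-- The isometric part of the polar decomposition of an injective element. -/
theorem exists_isometry_of_injective {M : VonNeumannAlgebra H} {T : H →L[ℂ] H} (hT : T ∈ M)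
    (hinj : ∀ ξ, T ξ = 0 → ξ = 0) :
    ∃ j ∈ M, star j * j = 1 ∧ ∀ p : H →L[ℂ] H, p * T = T → p * j = j := by
  set R : H →L[ℂ] H := CFC.abs T with hR
  have hRR : R * R = star T * T := CFC.abs_mul_abs T
  have hRs : star R = R := (CFC.abs_nonneg T).isSelfAdjoint.star_eq
  have hnorm : ∀ ξ, ‖T ξ‖ = ‖R ξ‖ := by
    have key : ∀ (A : H →L[ℂ] H) (ξ : H), inner ℂ (A ξ) (A ξ) = inner ℂ ((star A * A) ξ) ξ := by
      intro A ξ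
      rw [ContinuousLinearMap.star_eq_adjoint, mul_apply_eq_comp,
        ContinuousLinearMap.adjoint_inner_left]
    intro ξ
    have h1 : inner ℂ (T ξ) (T ξ) = inner ℂ (R ξ) (R ξ) := by
      rw [key, key R, hRs, hRR]
    rw [inner_self_eq_norm_sq_to_K, inner_self_eq_norm_sq_to_K] at h1
    have h2 : ‖T ξ‖ ^ 2 = ‖R ξ‖ ^ 2 := by exact_mod_cast h1
    exact (sq_eq_sq₀ (norm_nonneg _) (norm_nonneg _)).1 h2
  have hdense : DenseRange R := by
    have : (LinearMap.range R.toLinearMap).topologicalClosure = ⊤ := by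
      rw [Submodule.topologicalClosure_eq_top_iff, Submodule.eq_bot_iff]
      intro ξ hξ
      apply hinj
      rw [← norm_eq_zero, hnorm, norm_eq_zero]
      have h := (Submodule.mem_orthogonal _ _).1 hξ (R (R ξ)) ⟨R ξ, rfl⟩
      have h2 : inner ℂ (R (R ξ)) ξ = inner ℂ (R ξ) (R ξ) := by
        conv_lhs => rw [← hRs, ContinuousLinearMap.star_eq_adjoint,
          ContinuousLinearMap.adjoint_inner_left]
        rw [← ContinuousLinearMap.star_eq_adjoint, hRs]
      rw [h2] at h
      exact inner_self_eq_zero.1 h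
    have h3 := congrArg (fun S : Submodule ℂ H => (S : Set H)) this
    rw [DenseRange, dense_iff_closure_eq]
    simpa using! h3
  -- The rule `|T| ξ ↦ T ξ` is isometric, and injectivity of `T` makes its domain dense, so it
  -- extends to a full isometry.
  set j : H →L[ℂ] H := T.toLinearMap.extendOfNorm R.toLinearMap with hj
  have hjR : ∀ ξ, j (R ξ) = T ξ :=
    fun ξ => LinearMap.extendOfNorm_eq hdense ⟨1, fun x => by simp [hnorm]⟩ ξ
  have ext_dense : ∀ A B : H →L[ℂ] H, (∀ ξ, A (R ξ) = B (R ξ)) → A = B := by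
    intro A B h
    exact DFunLike.coe_injective
      (hdense.equalizer A.continuous B.continuous (funext h))
  refine ⟨j, mem_of_forall_commutant fun c hc => ?_, ?_, fun p hp => ?_⟩
  · have h1 : Commute T c := (commute_of_mem_commutant hT hc).symm
    have h2 : Commute T (star c) := (commute_of_mem_commutant hT (star_mem hc)).symm
    have h3 : Commute R c := h1.cfcAbs_left h2
    refine ext_dense _ _ fun ξ => ?_
    have e1 := DFunLike.congr_fun h3.eq ξ
    have e2 := DFunLike.congr_fun h1.eq ξ
    simp only [mul_apply_eq_comp] at e1 e2 ⊢
    rw [hjR, ← e1, hjR, e2]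
  · have hn : ∀ ξ, ‖j ξ‖ = ‖ξ‖ := by
      intro ξ
      refine hdense.induction_on (p := fun ξ => ‖j ξ‖ = ‖ξ‖) ξ
        (isClosed_eq (by fun_prop) (by fun_prop)) fun η => ?_
      rw [hjR, hnorm]
    rw [ContinuousLinearMap.star_eq_adjoint]
    exact (ContinuousLinearMap.norm_map_iff_adjoint_comp_self j).1 hn
  · refine ext_dense _ _ fun ξ => ?_
    rw [mul_apply_eq_comp, hjR]
    exact DFunLike.congr_fun hp ξ

/-- In a factor, `e M ξ ≠ 0` for all nonzero `e ∈ M` and nonzero vectors `ξ`. -/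
theorem IsFactor.exists_apply_ne_zero {M : VonNeumannAlgebra H} (hM : M.IsFactor)
    {e : H →L[ℂ] H} (he : e ∈ M) (he0 : e ≠ 0) {ξ : H} (hξ : ξ ≠ 0) :
    ∃ a ∈ M, (e * a) ξ ≠ 0 := by
  by_contra! hcon
  -- `{η | e M η = 0}` is invariant under both `M` and its commutant, so its projection is central,
  -- hence scalar. It fixes `ξ ≠ 0`, so it is `1`, and `a = 1` gives `e = 0`.
  let S : Submodule ℂ H := ⨅ a : M, LinearMap.ker (e * (a : H →L[ℂ] H)).toLinearMap
  have hS : ∀ η, η ∈ S ↔ ∀ a ∈ M, (e * a) η = 0 := by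
    intro η
    simp [S, Submodule.mem_iInf]
  have hSc : IsClosed (S : Set H) := by
    rw [Submodule.coe_iInf]
    exact isClosed_iInter fun a => (e * (a : H →L[ℂ] H)).isClosed_ker
  have : CompleteSpace S := hSc.completeSpace_coe
  have hz1 : S.starProjection ∈ M := by
    refine starProjection_mem S fun c hc η hη => (hS _).2 fun a ha => ?_
    have h := DFunLike.congr_fun (commute_of_mem_commutant (mul_mem he ha) hc) η
    rw [mul_apply_eq_comp, (hS η).1 hη a ha, map_zero] at h
    exact h.symm
  have hz2 : S.starProjection ∈ M.commutant := by
    refine starProjection_mem S fun c hc η hη => (hS _).2 fun a ha => ?_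
    rw [commutant_commutant] at hc
    exact (hS η).1 hη (a * c) (mul_mem ha hc)
  obtain ⟨r, hr⟩ := hM.center _ hz1 hz2
  have h1 : S.starProjection ξ = ξ := Submodule.starProjection_eq_self_iff.2 ((hS ξ).2 hcon)
  have hr1 : r = 1 := by
    rw [hr] at h1
    have h2 : (r - 1) • ξ = 0 := by
      rw [sub_smul, one_smul, sub_eq_zero]
      exact h1
    exact sub_eq_zero.1 ((smul_eq_zero.1 h2).resolve_right hξ)
  apply he0
  ext η
  have h2 : η ∈ S := by
    rw [← Submodule.starProjection_eq_self_iff, hr, hr1]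
    simp
  simpa using (hS η).1 h2 1 (one_mem M)

/-- In a factor on a separable Hilbert space, a projection dominating infinitely many orthogonal
copies of a nonzero projection `e` dominates the range of an isometry. -/
theorem IsFactor.exists_isometry [TopologicalSpace.SeparableSpace H] {M : VonNeumannAlgebra H}
    (hM : M.IsFactor) {e p : H →L[ℂ] H} (he : e ∈ M) (he0 : e ≠ 0) (hep : IsStarProjection e)
    (t : ℕ → H →L[ℂ] H) (ht : ∀ n, t n ∈ M) (htt : ∀ n, star (t n) * t n = e)
    (hto : ∀ n k, n ≠ k → star (t n) * t k = 0) (hpt : ∀ n, p * t n = t n) :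
    ∃ j ∈ M, star j * j = 1 ∧ p * j = j := by
  -- Lindelöf: the open sets `{ξ | e a ξ ≠ 0}`, `a ∈ M`, cover the nonzero vectors, so countably
  -- many of them do.
  obtain ⟨a, haM, ha⟩ : ∃ a : ℕ → H →L[ℂ] H, (∀ n, a n ∈ M) ∧
      ∀ ξ, ξ ≠ 0 → ∃ n, (e * a n) ξ ≠ 0 := by
    let U : M → Set H := fun a => {ξ | (e * (a : H →L[ℂ] H)) ξ ≠ 0}
    have hU : ∀ a, IsOpen (U a) := fun a =>
      isOpen_ne_fun (e * (a : H →L[ℂ] H)).continuous continuous_const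
    have : SecondCountableTopology H := UniformSpace.secondCountable_of_separable H
    obtain ⟨T, hTc, hT⟩ := TopologicalSpace.isOpen_iUnion_countable U hU
    obtain ⟨f, hf⟩ := (hTc.insert (0 : M)).exists_eq_range (Set.insert_nonempty _ _)
    refine ⟨fun n => f n, fun n => (f n).2, fun ξ hξ => ?_⟩
    obtain ⟨b, hb, hb'⟩ := hM.exists_apply_ne_zero he he0 hξ
    have h1 : ξ ∈ ⋃ i, U i := Set.mem_iUnion.2 ⟨⟨b, hb⟩, hb'⟩
    rw [← hT] at h1
    obtain ⟨i, hi, hi'⟩ := Set.mem_iUnion₂.1 h1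
    obtain ⟨n, rfl⟩ : i ∈ Set.range f := hf ▸ Set.mem_insert_of_mem _ hi
    exact ⟨n, hi'⟩
  have hte : ∀ n k, star (t n) * (t k * (e * a k)) = if n = k then e * a n else 0 := by
    intro n k
    split_ifs with h
    · subst h
      rw [← mul_assoc, htt, ← mul_assoc, hep.isIdempotentElem.eq]
    · rw [← mul_assoc, hto n k h, zero_mul]
  -- The weights make `∑ rₙ tₙ e aₙ` converge in norm. Multiplying by `tₙ*` isolates `rₙ e aₙ`, so
  -- the sum is injective, and its polar part is the isometry sought.
  let r : ℕ → ℝ := fun n => (1 / 2) ^ n / (1 + ‖t n * (e * a n)‖)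
  have hr : ∀ n, 0 < r n := fun n => by positivity
  let f : ℕ → H →L[ℂ] H := fun n => (r n : ℂ) • (t n * (e * a n))
  have hf : Summable f := by
    refine Summable.of_norm_bounded (g := fun n => (1 / 2 : ℝ) ^ n)
      (summable_geometric_of_lt_one (by norm_num) (by norm_num)) fun n => ?_
    rw [norm_smul, Complex.norm_real, Real.norm_of_nonneg (hr n).le, div_mul_eq_mul_div,
      div_le_iff₀ (by positivity)]
    gcongr
    linarith
  have hfM : ∑' n, f n ∈ M := by
    refine M.isClosed.mem_of_tendsto hf.hasSum (Filter.Eventually.of_forall fun s => ?_)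
    exact sum_mem fun n _ => smul_mem' _ (mul_mem (ht n) (mul_mem he (haM n)))
  have hpf : p * ∑' n, f n = ∑' n, f n := by
    rw [← hf.tsum_mul_left]
    refine tsum_congr fun n => ?_
    rw [mul_smul_comm, ← mul_assoc, hpt]
  have hsf : ∀ n, star (t n) * ∑' k, f k = (r n : ℂ) • (e * a n) := by
    intro n
    rw [← hf.tsum_mul_left, tsum_eq_single n]
    · rw [mul_smul_comm, hte, if_pos rfl]
    · intro k hk
      rw [mul_smul_comm, hte, if_neg hk.symm, smul_zero]
  obtain ⟨j, hjM, hj1, hj2⟩ := exists_isometry_of_injective hfM (by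
    intro ξ hξ
    by_contra h0
    obtain ⟨n, hn⟩ := ha ξ h0
    have h1 := DFunLike.congr_fun (hsf n) ξ
    rw [mul_apply_eq_comp, hξ, map_zero, smul_apply] at h1
    exact hn ((smul_eq_zero.1 h1.symm).resolve_left (by exact_mod_cast (hr n).ne')))
  exact ⟨j, hjM, hj1, hj2 p hpf⟩

/-- Schröder–Bernstein: a projection dominating the range of an isometry is the range projection
of an isometry. -/
theorem exists_isometry_range_eq {M : VonNeumannAlgebra H} {p j : H →L[ℂ] H}
    (hp : p ∈ M) (hpp : IsStarProjection p) (hj : j ∈ M) (hjj : star j * j = 1)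
    (hpj : p * j = j) :
    ∃ u ∈ M, star u * u = 1 ∧ u * star u = p := by
  have hps : star p = p := hpp.isSelfAdjoint.star_eq
  have hp2 : p * p = p := hpp.isIdempotentElem.eq
  -- With `g` the projection onto the closed span of the ranges of `jⁿ(1 - p)`, one has `g = (1 - p)
  -- + j g j*`. Hence `u = j g + (1 - g)`, which shifts by `j` on this span and is the identity off
  -- it, has range projection `j g j* + 1 - g = p`.
  let G : Set H := {ξ | ∃ (n : ℕ) (η : H), ξ = (j ^ n * (1 - p)) η}
  let S : Submodule ℂ H := (Submodule.span ℂ G).topologicalClosure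
  have hGS : ∀ ξ ∈ G, ξ ∈ S := fun ξ h =>
    (Submodule.span ℂ G).le_topologicalClosure (Submodule.subset_span h)
  have : CompleteSpace S := (Submodule.isClosed_topologicalClosure _).completeSpace_coe
  have hind : ∀ (q : Submodule ℂ H), IsClosed (q : Set H) → G ⊆ q → S ≤ q := fun q hq h =>
    Submodule.topologicalClosure_minimal _ (Submodule.span_le.2 h) hq
  have hinv : ∀ c : H →L[ℂ] H, (∀ ξ ∈ G, c ξ ∈ S) → ∀ ξ ∈ S, c ξ ∈ S := fun c hc =>
    hind (S.comap c.toLinearMap)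
      ((Submodule.isClosed_topologicalClosure _).preimage c.continuous) hc
  set g := S.starProjection with hg
  have hgM : g ∈ M := by
    refine starProjection_mem S fun c hc => hinv c ?_
    rintro _ ⟨n, η, rfl⟩
    refine hGS _ ⟨n, c η, ?_⟩
    exact DFunLike.congr_fun (commute_of_mem_commutant
      (mul_mem (pow_mem hj n) (sub_mem (one_mem M) hp)) hc) η
  have hgs : star g = g := isStarProjection_starProjection.isSelfAdjoint.star_eq
  have hg2 : g * g = g := isStarProjection_starProjection.isIdempotentElem.eq
  have hgS : ∀ ξ, ξ ∈ S → g ξ = ξ := fun ξ h => Submodule.starProjection_eq_self_iff.2 h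
  have hmem : ∀ ξ, g ξ ∈ S := fun ξ => Submodule.starProjection_apply_mem S ξ
  have hjS : ∀ ξ ∈ S, j ξ ∈ S := by
    refine hinv j ?_
    rintro _ ⟨n, η, rfl⟩
    refine hGS _ ⟨n + 1, η, ?_⟩
    rw [pow_succ', mul_assoc]
    rfl
  have hgj : g * j * g = j * g := by
    ext ξ
    exact hgS _ (hjS _ (hmem ξ))
  have hgp : g * (1 - p) = 1 - p := by
    ext ξ
    exact hgS _ (hGS _ ⟨0, ξ, by simp⟩)
  have hjp : star j * (1 - p) = 0 := by
    rw [mul_sub, mul_one]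
    conv_lhs => rw [← hpj, star_mul, hps]
    rw [mul_assoc, hp2, sub_self]
  have hP : ((1 - p) + j * g * star j) * g = g := by
    ext ξ
    have : S ≤ LinearMap.eqLocus ((1 - p) + j * g * star j).toLinearMap
        (LinearMap.id) ⊓ S := by
      refine hind _ ?_ ?_
      · exact (isClosed_eq ((1 - p) + j * g * star j).continuous continuous_id).inter
          (Submodule.isClosed_topologicalClosure _)
      · rintro _ ⟨n, η, rfl⟩
        refine ⟨?_, hGS _ ⟨n, η, rfl⟩⟩
        have key : ((1 - p) + j * g * star j) * (j ^ n * (1 - p)) = j ^ n * (1 - p) := by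
          cases n with
          | zero =>
            rw [pow_zero, one_mul, add_mul, mul_assoc _ (star j), hjp, mul_zero, add_zero,
              hpp.one_sub.isIdempotentElem.eq]
          | succ n =>
            have h1 : g * (j ^ n * (1 - p)) = j ^ n * (1 - p) := by
              ext ζ
              exact hgS _ (hGS _ ⟨n, ζ, rfl⟩)
            have h2 : (1 - p) * j = 0 := by rw [sub_mul, one_mul, hpj, sub_self]
            calc _ = (1 - p) * j * (j ^ n * (1 - p))
                  + j * (g * ((star j * j) * (j ^ n * (1 - p)))) := by
                  rw [pow_succ']; noncomm_ring
              _ = _ := by rw [h2, hjj, one_mul, h1, zero_mul, zero_add, pow_succ', mul_assoc]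
        exact DFunLike.congr_fun key η
    exact (this (hmem ξ)).1
  have hPs : g * ((1 - p) + j * g * star j) = (1 - p) + j * g * star j := by
    rw [mul_add, hgp, ← mul_assoc, ← mul_assoc, hgj]
  -- The left side is self-adjoint, so the adjoint of `hP` can be compared with `hPs`.
  have hP' : (1 - p) + j * g * star j = g := by
    have := congrArg star hP
    rw [star_mul, hgs, star_add, star_sub, star_one, hps, star_mul, star_mul, star_star, hgs,
      ← mul_assoc, hPs] at this
    exact this
  have hgj' : (1 - g) * j * g = 0 := by
    rw [sub_mul, sub_mul, one_mul, hgj, sub_self]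
  have hgj'' : g * star j * (1 - g) = 0 := by
    have := congrArg star hgj'
    simpa [hgs, mul_assoc] using this
  refine ⟨j * g + (1 - g), add_mem (mul_mem hj hgM) (sub_mem (one_mem M) hgM), ?_, ?_⟩
  · calc _ = g * (star j * j) * g + (1 - g) * j * g + g * star j * (1 - g)
          + (1 - g) * (1 - g) := by
          rw [star_add, star_mul, star_sub, star_one, hgs]; noncomm_ring
      _ = 1 := by
          rw [hjj, hgj', hgj'', mul_one, hg2]
          simp [mul_sub, sub_mul, hg2]
  · calc _ = j * (g * g) * star j + j * (g - g * g) + (g - g * g) * star j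
          + (1 - g) * (1 - g) := by
          rw [star_add, star_mul, star_sub, star_one, hgs]; noncomm_ring
      _ = j * g * star j + (1 - g) := by
          rw [hg2]
          simp [mul_sub, sub_mul, hg2]
      _ = p := by
          rw [← eq_sub_iff_add_eq'] at hP'
          rw [hP']; abel

end VonNeumannAlgebra

/-! ### Idempotents commuting with a properly infinite subalgebra -/

namespace VonNeumannAlgebra

variable {H : Type*} [NormedAddCommGroup H] [InnerProductSpace ℂ H] [CompleteSpace H]

/-- The range projection of an idempotent. -/
theorem exists_range_projection {M : VonNeumannAlgebra H} {e : H →L[ℂ] H} (he : e ∈ M)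
    (hee : e * e = e) :
    ∃ p ∈ M, IsStarProjection p ∧ e * p = p ∧ p * e = e ∧
      ∀ c : H →L[ℂ] H, e * c = c * e → e * star c = star c * e → p * c = c * p := by
  -- The range of the idempotent, written as a kernel so that closedness is immediate.
  let S : Submodule ℂ H := LinearMap.ker (1 - e).toLinearMap
  have hS : ∀ ξ, ξ ∈ S ↔ e ξ = ξ := fun ξ => by
    rw [LinearMap.mem_ker, ContinuousLinearMap.coe_coe, sub_apply,
      one_apply_eq_self, sub_eq_zero, eq_comm]
  have : CompleteSpace S := (1 - e).isClosed_ker.completeSpace_coe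
  have hpp : IsStarProjection S.starProjection := isStarProjection_starProjection
  have hcp : ∀ c : H →L[ℂ] H, e * c = c * e →
      S.starProjection * c * S.starProjection = c * S.starProjection := by
    intro c hc
    ext ξ
    refine Submodule.starProjection_eq_self_iff.2 ((hS _).2 ?_)
    have h1 := DFunLike.congr_fun hc (S.starProjection ξ)
    rw [mul_apply_eq_comp, mul_apply_eq_comp,
      (hS _).1 (Submodule.starProjection_apply_mem S ξ)] at h1
    exact h1
  refine ⟨S.starProjection, starProjection_mem S fun c hc ξ hξ => ?_, hpp, ?_, ?_, ?_⟩
  · rw [hS] at hξ ⊢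
    have h1 := DFunLike.congr_fun (commute_of_mem_commutant he hc) ξ
    rw [mul_apply_eq_comp, mul_apply_eq_comp, hξ] at h1
    exact h1.symm
  · ext ξ
    exact (hS _).1 (Submodule.starProjection_apply_mem S ξ)
  · ext ξ
    exact Submodule.starProjection_eq_self_iff.2 ((hS _).2 (DFunLike.congr_fun hee ξ))
  · intro c h1 h2
    have h3 := congrArg star (hcp _ h2)
    rw [star_mul, star_mul, star_mul, star_star, hpp.isSelfAdjoint.star_eq, ← mul_assoc] at h3
    rw [← h3, hcp c h1]

/-- An idempotent in the relative commutant of a properly infinite subalgebra of a factor has the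
same range as an isometry. -/
theorem IsFactor.exists_isometry_of_idempotent [TopologicalSpace.SeparableSpace H]
    {M : VonNeumannAlgebra H} (hM : M.IsFactor)
    {A : Type*} [Ring A] [StarRing A] [Algebra ℂ A] (α : A →⋆ₐ[ℂ] M.Elt)
    {e : M.Elt} (he : e * e = e) (hc : ∀ n, e * α n = α n * e)
    {u : A} (hu : star u * u = 1) (hne : α (1 - u * star u) * e ≠ 0) :
    ∃ V : M.Elt, star V * V = 1 ∧ V * star V * e = e ∧ e * (V * star V) = V * star V ∧
      ∀ n, V * star V * α n = α n * (V * star V) := by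
  obtain ⟨p, hpM, hpp, hep, hpe, hpc⟩ :=
    exists_range_projection (M := M) e.2 (congrArg Subtype.val he)
  lift p to M.Elt using hpM
  have hep' : e * p = p := Subtype.ext hep
  have hpe' : p * e = e := Subtype.ext hpe
  have hps : star p = p := Subtype.ext hpp.isSelfAdjoint.star_eq
  have hp2 : p * p = p := Subtype.ext hpp.isIdempotentElem.eq
  have hpα : ∀ n, p * α n = α n * p := fun n => by
    refine Subtype.ext (hpc (α n) (congrArg Subtype.val (hc n)) ?_)
    have := congrArg Subtype.val (hc (star n))
    rw [map_star] at this
    exact this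
  have huu : ∀ n : ℕ, star u ^ n * u ^ n = 1 := by
    intro n
    induction n with
    | zero => simp
    | succ n ih =>
      rw [pow_succ, pow_succ', mul_assoc, ← mul_assoc (star u) u, hu, one_mul, ih]
  -- `q` is the wandering projection of `u`: the `uⁿ q u*ⁿ` are mutually orthogonal and equivalent
  -- to `q`. Cutting their images under `α` by `p` gives the partial isometries `t n` below.
  set q := 1 - u * star u with hq
  have hqs : star q = q := by simp [hq]
  have huq : star u * q = 0 := by rw [hq, mul_sub, mul_one, ← mul_assoc, hu, one_mul, sub_self]
  have hqu : q * u = 0 := by rw [hq, sub_mul, one_mul, mul_assoc, hu, mul_one, sub_self]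
  have hq2 : q * q = q := by
    conv_lhs => rw [hq, sub_mul, one_mul, mul_assoc, huq, mul_zero, sub_zero]
  have horth : ∀ n k, n < k → q * (star u ^ n * u ^ k) * q = 0 := by
    intro n k h
    obtain ⟨m, rfl⟩ := Nat.exists_eq_add_of_lt h
    rw [add_assoc, pow_add, ← mul_assoc (star u ^ n), huu, one_mul, pow_succ', ← mul_assoc, hqu,
      zero_mul, zero_mul]
  have horth' : ∀ n k, n ≠ k → q * (star u ^ n * u ^ k) * q = 0 := by
    intro n k h
    rcases h.lt_or_gt with h | h
    · exact horth n k h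
    · have := congrArg star (horth k n h)
      simpa [hqs, mul_assoc] using this
  let t : ℕ → M.Elt := fun n => α (u ^ n * q) * p
  have ht : ∀ n k, star (t n) * t k = α (q * (star u ^ n * u ^ k) * q) * p := by
    intro n k
    calc star (t n) * t k = p * (α (star (u ^ n * q)) * α (u ^ k * q)) * p := by
          simp only [t, star_mul, hps, ← map_star, mul_assoc]
      _ = _ := by
          rw [← map_mul, hpα, mul_assoc, hp2, star_mul, hqs, star_pow]
          simp only [mul_assoc]
  have htt : ∀ n, star (t n) * t n = α q * p := fun n => by
    rw [ht, huu, mul_one, hq2]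
  obtain ⟨j, hjM, hj1, hj2⟩ := hM.exists_isometry (e := ((α q * p : M.Elt) : H →L[ℂ] H))
    (p := (p : H →L[ℂ] H)) (α q * p).2 (fun h => hne (by
      have h' : α q * p = 0 := Subtype.ext h
      rw [← hpe', ← mul_assoc, h', zero_mul]))
    ⟨by
      have : (α q * p) * (α q * p) = α q * p := by
        rw [mul_assoc, ← mul_assoc p, hpα, mul_assoc, hp2, ← mul_assoc, ← map_mul, hq2]
      exact congrArg Subtype.val this, by
      have : star (α q * p) = α q * p := by
        rw [star_mul, hps, ← map_star, hqs, hpα]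
      exact congrArg Subtype.val this⟩
    (fun n => (t n : H →L[ℂ] H)) (fun n => (t n).2) (fun n => congrArg Subtype.val (htt n))
    (fun n k h => by
      have : star (t n) * t k = 0 := by rw [ht, horth' n k h, map_zero, zero_mul]
      exact congrArg Subtype.val this)
    (fun n => by
      have : p * t n = t n := by
        simp only [t]
        rw [← mul_assoc, hpα, mul_assoc, hp2]
      exact congrArg Subtype.val this)
  obtain ⟨V, hVM, hV1, hV2⟩ := exists_isometry_range_eq (M := M) p.2 hpp hjM hj1 hj2
  lift V to M.Elt using hVM
  have hV2' : V * star V = p := Subtype.ext hV2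
  refine ⟨V, Subtype.ext hV1, ?_⟩
  rw [hV2']
  exact ⟨hpe', hep', hpα⟩

end VonNeumannAlgebra

/-! ### Faithfulness from the conjugacy relations -/

/-- The intertwiner `w` has the left inverse `α'(w')*`, so `w n = α'(α n) w` determines `n` from `α
n`. -/
theorem IsConjugatePair.injective_left {A B : Type*} [Ring A] [StarRing A] [Algebra ℂ A] [Ring B]
    [StarRing B] [Algebra ℂ B] {α : A →⋆ₐ[ℂ] B} {α' : B →⋆ₐ[ℂ] A} {w : A} {w' : B}
    (h : IsConjugatePair α α' w w') : Function.Injective α := by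
  rw [injective_iff_map_eq_zero]
  intro n hn
  have h1 : w * n = 0 := by
    rw [show w * n = α' (α n) * w from h.w_mem n, hn, map_zero, zero_mul]
  have h2 : star (α' w') * w = 1 := by
    have := congrArg star h.left
    rwa [star_mul, star_star, star_one] at this
  rw [← one_mul n, ← h2, mul_assoc, h1, mul_zero]

theorem IsConjugatePair.injective_right {A B : Type*} [Ring A] [StarRing A] [Algebra ℂ A] [Ring B]
    [StarRing B] [Algebra ℂ B] {α : A →⋆ₐ[ℂ] B} {α' : B →⋆ₐ[ℂ] A} {w : A} {w' : B}
    (h : IsConjugatePair α α' w w') : Function.Injective α' := by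
  rw [injective_iff_map_eq_zero]
  intro n hn
  have h1 : w' * n = 0 := by
    rw [show w' * n = α (α' n) * w' from h.w'_mem n, hn, map_zero, zero_mul]
  rw [← one_mul n, ← h.right, mul_assoc, h1, mul_zero]

theorem HasFiniteDim.injective {A B : Type*} [Ring A] [StarRing A] [Algebra ℂ A] [Ring B]
    [StarRing B] [Algebra ℂ B] {α : A →⋆ₐ[ℂ] B} (h : HasFiniteDim α) :
    Function.Injective α := by
  obtain ⟨_, _, _, _, hw, -⟩ := h
  exact hw.injective_left

/-! ### Module identities and the functor to modules -/

namespace QSystem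

variable {A : Type*} [Ring A] [StarRing A] [Algebra ℂ A] {C : Set (A →⋆ₐ[ℂ] A)} {Q : QSystem C}

theorem star_w_mul (Q : QSystem C) (n : A) : star Q.w * Q.θ n = n * star Q.w := by
  have := congrArg star (Q.w_mem (star n))
  change star (Q.w * star n) = star (Q.θ (star n) * Q.w) at this
  rw [star_mul, star_mul, ← map_star, star_star] at this
  exact this.symm

theorem star_x_mul (Q : QSystem C) (n : A) : star Q.x * Q.θ (Q.θ n) = Q.θ n * star Q.x := by
  have := congrArg star (Q.x_mem (star n))
  change star (Q.x * Q.θ (star n)) = star (Q.θ (Q.θ (star n)) * Q.x) at this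
  rw [star_mul, star_mul, ← map_star, ← map_star, ← map_star, star_star] at this
  exact this.symm

/-- Left multiplication by `x* θ(m)` is `d` times an idempotent. -/
theorem IsModule.idempotent {β : A →⋆ₐ[ℂ] A} {m : A} (h : Q.IsModule β m) :
    star Q.x * Q.θ m * (star Q.x * Q.θ m) = (√(homDim Q.θ) : ℂ) • (star Q.x * Q.θ m) := by
  calc _ = star Q.x * (Q.θ m * star Q.x) * Q.θ m := by simp only [mul_assoc]
    _ = star Q.x * star Q.x * Q.θ (Q.θ m * m) := by
      rw [← star_x_mul, map_mul]; simp only [mul_assoc]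
    _ = star Q.x * (star Q.x * Q.θ Q.x) * Q.θ m := by
      rw [h.repr, map_mul]; simp only [mul_assoc]
    _ = _ := by
      rw [← Q.frobenius_right, ← mul_assoc, Q.standard_x]
      simp only [smul_mul_assoc, one_mul]

/-- In terms of the idempotent `ι'(e) = d⁻¹ x* θ(m)`, this places the range of `m` inside that of
`ι'(e)`. -/
theorem IsModule.absorb {β : A →⋆ₐ[ℂ] A} {m : A} (h : Q.IsModule β m) :
    star Q.x * Q.θ m * m = (√(homDim Q.θ) : ℂ) • m := by
  rw [mul_assoc, h.repr, ← mul_assoc, Q.standard_x, smul_mul_assoc, one_mul]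

/-- Since `w* θ(m) = m w*`, this says that `m w*` is the identity on the range of `ι'(e)`; it is the
converse inclusion to `absorb`. -/
theorem IsModule.star_w_mul_mul {β : A →⋆ₐ[ℂ] A} {m : A} (h : Q.IsModule β m) :
    star Q.w * Q.θ m * (star Q.x * Q.θ m) = star Q.x * Q.θ m := by
  calc _ = star Q.w * (Q.θ m * star Q.x) * Q.θ m := by simp only [mul_assoc]
    _ = star Q.w * star Q.x * Q.θ (Q.θ m * m) := by
      rw [← star_x_mul, map_mul]; simp only [mul_assoc]
    _ = star Q.w * (star Q.x * Q.θ Q.x) * Q.θ m := by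
      rw [h.repr, map_mul]; simp only [mul_assoc]
    _ = _ := by
      rw [← Q.frobenius_right, ← mul_assoc, Q.unit_left, one_mul]

namespace Extension

variable {M : Type*} [Ring M] [StarRing M] [Algebra ℂ M] (E : Q.Extension M)

theorem θ_apply (n : A) : Q.θ n = E.ι' (E.ι n) := by
  rw [← E.comp_eq]; rfl

theorem v_mul (s : M) : E.v * s = E.ι (E.ι' s) * E.v :=
  E.standard.w'_mem s

theorem star_v_mul (s : M) : star E.v * E.ι (E.ι' s) = s * star E.v := by
  have := congrArg star (E.v_mul (star s))
  rw [star_mul, star_mul, ← map_star, ← map_star, star_star] at this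
  exact this.symm

theorem ι'_injective : Function.Injective E.ι' :=
  E.standard.injective_right

theorem x_mul (s : M) : Q.x * E.ι' s = Q.θ (E.ι' s) * Q.x := by
  rw [← E.map_v, ← map_mul, E.v_mul, map_mul, ← θ_apply]

theorem isStandardModule (φ : A →⋆ₐ[ℂ] M) : Q.IsStandardModule (E.ι'.comp φ) Q.x where
  m_mem n := E.x_mul (φ n)
  unit := Q.unit_left
  repr := Q.associativity.symm
  standard := ⟨_, Q.standard_x⟩

theorem isModuleHom_iff (φ φ' : A →⋆ₐ[ℂ] M) (t : A) :
    Q.IsModuleHom (E.ι'.comp φ) Q.x (E.ι'.comp φ') Q.x t ↔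
      ∃ s : M, IsIntertwiner φ φ' s ∧ t = E.ι' s := by
  constructor
  · intro h
    have ht : t = E.ι' (E.ι (star Q.w) * E.ι t * E.v) := by
      rw [map_mul, map_mul, ← E.θ_apply, ← E.θ_apply, E.map_v, mul_assoc, h.comm, ← mul_assoc,
        Q.unit_right, one_mul]
    refine ⟨_, fun n => E.ι'_injective ?_, ht⟩
    rw [map_mul, map_mul _ (φ' n), ← ht]
    exact h.intertwines n
  · rintro ⟨s, hs, rfl⟩
    refine ⟨fun n => ?_, (E.x_mul s).symm⟩
    change E.ι' s * E.ι' (φ n) = E.ι' (φ' n) * E.ι' s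
    rw [← map_mul, hs, map_mul]

/-- The functor `φ ↦ (ι' ∘ φ, x)`. -/
def toMod (hC : IsTensorSubcategory C) : E.subHoms.FullSubcategory ⥤ Q.Mod where
  obj φ :=
    { β := E.ι'.comp φ.obj.toHom
      m := Q.x
      -- `ι'` maps an isometry in `Hom(φ, ιρ)` to one in `Hom(ι'φ, θρ)`.
      β_mem := by
        obtain ⟨ρ, hρ, s, hs, hss⟩ := φ.property
        refine hC.sub_mem _ (hC.comp_mem _ Q.θ_mem _ hρ) _ ⟨E.ι' s, fun n => ?_, ?_⟩
        · change E.ι' s * E.ι' (φ.obj.toHom n) = Q.θ (ρ n) * E.ι' s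
          rw [← map_mul, hs, map_mul, E.θ_apply]
          rfl
        · rw [← map_star, ← map_mul, hss, map_one]
      isModule := (E.isStandardModule _).toIsModule }
  map s := ⟨E.ι' s.hom.1, (E.isModuleHom_iff _ _ _).2 ⟨_, s.hom.2, rfl⟩⟩
  map_id _ := Subtype.ext (map_one E.ι')
  map_comp s t := Subtype.ext (map_mul E.ι' t.hom.1 s.hom.1)

instance (hC : IsTensorSubcategory C) : (E.toMod hC).Faithful where
  map_injective h :=
    InducedCategory.hom_ext (Subtype.ext (E.ι'_injective (congrArg Subtype.val h)))

instance (hC : IsTensorSubcategory C) : (E.toMod hC).Full where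
  map_surjective t := by
    obtain ⟨s, hs, hts⟩ := (E.isModuleHom_iff _ _ _).1 t.2
    exact ⟨InducedCategory.homMk ⟨s, hs⟩, Subtype.ext hts.symm⟩

/-- A module whose idempotent `d⁻¹ v* ι(m)` has the same range as an isometry `V` intertwining
`φ` and `ι ∘ β` is isomorphic to `(ι' ∘ φ, x)`. -/
theorem exists_iso_of_isometry (hC : IsTensorSubcategory C) (X : Q.Mod)
    (hd : (√(homDim Q.θ) : ℂ) ≠ 0) {e V : M}
    (he : (√(homDim Q.θ) : ℂ) • e = star E.v * E.ι X.m)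
    (hV : star V * V = 1) (hVe : V * star V * e = e) (heV : e * (V * star V) = V * star V)
    (hc : ∀ n, V * star V * E.ι (X.β n) = E.ι (X.β n) * (V * star V)) :
    ∃ φ : E.subHoms.FullSubcategory, Nonempty ((E.toMod hC).obj φ ≅ X) := by
  have hVi (n : A) : V * (star V * E.ι (X.β n) * V) = E.ι (X.β n) * V := by
    rw [← mul_assoc, ← mul_assoc, hc, mul_assoc, mul_assoc, hV, mul_one]
  let φ : A →⋆ₐ[ℂ] M :=
    { toFun := fun n => star V * E.ι (X.β n) * V
      map_one' := by simp [hV]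
      map_zero' := by simp
      map_mul' := fun a b => by
        rw [mul_assoc (star V * E.ι (X.β a)), hVi, map_mul, map_mul]
        simp only [mul_assoc]
      map_add' := fun a b => by simp [mul_add, add_mul]
      commutes' := fun r => by
        simp [Algebra.algebraMap_eq_smul_one, hV]
      map_star' := fun a => by
        rw [star_mul, star_mul, star_star, map_star, map_star, mul_assoc] }
  have hφ (n : A) : V * φ n = E.ι (X.β n) * V := hVi n
  have hι'e : (√(homDim Q.θ) : ℂ) • E.ι' e = star Q.x * Q.θ X.m := by
    rw [← map_smul, he, map_mul, map_star, E.map_v, E.θ_apply]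
  have hem : E.ι' e * X.m = X.m := by
    apply smul_right_injective A hd
    change _ • _ = _ • _
    rw [← smul_mul_assoc, hι'e, X.isModule.absorb]
  have hVm : E.ι' V * (E.ι' (star V) * X.m) = X.m := by
    rw [← mul_assoc, ← map_mul, ← hem, ← mul_assoc, ← map_mul, hVe]
  have heV' : e * V = V := by
    calc e * V = e * (V * star V) * V := by rw [mul_assoc, mul_assoc, hV, mul_one]
      _ = V := by rw [heV, mul_assoc, hV, mul_one]
  have hwe : star Q.w * Q.θ X.m * E.ι' e = E.ι' e := by
    apply smul_right_injective A hd
    change _ • _ = _ • _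
    rw [← mul_smul_comm, hι'e, X.isModule.star_w_mul_mul]
  have hmV : X.m * (star Q.w * E.ι' V) = E.ι' V := by
    rw [← mul_assoc, ← Q.star_w_mul, ← heV', map_mul, ← mul_assoc, hwe]
  -- The object `ρ` of `C` with `φ ≺ ιρ` is `β` itself.
  refine ⟨⟨⟨φ⟩, X.β, X.β_mem, V, hφ, hV⟩, ⟨?_⟩⟩
  refine
    { hom := ⟨star Q.w * E.ι' V, fun n => ?_, ?_⟩
      inv := ⟨E.ι' (star V) * X.m, fun n => ?_, ?_⟩
      hom_inv_id := Subtype.ext ?_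
      inv_hom_id := Subtype.ext ?_ }
  · change star Q.w * E.ι' V * E.ι' (φ n) = X.β n * (star Q.w * E.ι' V)
    rw [mul_assoc, ← map_mul, hφ, map_mul, ← E.θ_apply, ← mul_assoc, Q.star_w_mul, mul_assoc]
  · change Q.θ (star Q.w * E.ι' V) * Q.x = X.m * (star Q.w * E.ι' V)
    rw [hmV, map_mul, mul_assoc, ← E.x_mul, ← mul_assoc, Q.unit_right, one_mul]
  · change E.ι' (star V) * X.m * X.β n = E.ι' (φ n) * (E.ι' (star V) * X.m)
    have h1 : φ n * star V = star V * E.ι (X.β n) := by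
      have := congrArg star (hφ (star n))
      rwa [star_mul, star_mul, ← map_star, ← map_star, ← map_star, star_star] at this
    rw [mul_assoc, show X.m * X.β n = Q.θ (X.β n) * X.m from X.isModule.m_mem n, E.θ_apply,
      ← mul_assoc, ← mul_assoc, ← map_mul, ← map_mul, h1]
  · change Q.θ (E.ι' (star V) * X.m) * X.m = Q.x * (E.ι' (star V) * X.m)
    rw [map_mul, mul_assoc, X.isModule.repr, ← mul_assoc, ← E.x_mul, mul_assoc]
  · change E.ι' (star V) * X.m * (star Q.w * E.ι' V) = 1
    rw [mul_assoc, hmV, ← map_mul, hV, map_one]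
  · change star Q.w * E.ι' V * (E.ι' (star V) * X.m) = 1
    rw [mul_assoc, hVm, X.isModule.unit]

end Extension

end QSystem

/-! ### Essential surjectivity and the main theorem -/

theorem QSystem.Extension.toMod_essSurj
    {H : Type*} [NormedAddCommGroup H] [InnerProductSpace ℂ H] [CompleteSpace H]
    {N : VonNeumannAlgebra H} (hN : N.IsInfiniteFactor)
    {C : Set (N.Elt →⋆ₐ[ℂ] N.Elt)} (hC : IsTensorSubcategory C) {Q : QSystem C}
    {K : Type*} [NormedAddCommGroup K] [InnerProductSpace ℂ K] [CompleteSpace K]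
    [TopologicalSpace.SeparableSpace K]
    {M : VonNeumannAlgebra K} (E : Q.Extension M.Elt) (hM : M.IsFactor) :
    (E.toMod hC).EssSurj where
  mem_essImage X := by
    have := hN.nontrivial
    set d : ℂ := (√(homDim Q.θ) : ℂ) with hdef
    have hd : d ≠ 0 := by
      -- If `d = 0` then `w* w = 0`, so `w = 0`, against `w* x = 1`.
      intro h
      have h1 : star (Q.w : H →L[ℂ] H) * Q.w = 0 := by
        have := Q.standard_w
        rw [← hdef, h, zero_smul] at this
        exact congrArg Subtype.val this
      have h2 : Q.w = 0 := Subtype.ext (CStarRing.star_mul_self_eq_zero_iff _ |>.1 h1)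
      have h3 := Q.unit_left
      rw [h2, star_zero, zero_mul] at h3
      exact zero_ne_one (congrArg Subtype.val h3)
    obtain ⟨u, huN, hu, -, hu1⟩ := hN.infinite 1 (one_mem N) (.one _) one_ne_zero
    lift u to N.Elt using huN
    set e : M.Elt := d⁻¹ • (star E.v * E.ι X.m) with he
    have hde : d • e = star E.v * E.ι X.m := smul_inv_smul₀ hd _
    have hι'e : d • E.ι' e = star Q.x * Q.θ X.m := by
      rw [← map_smul, hde, map_mul, map_star, E.map_v, E.θ_apply]
    -- The identity is checked after applying the injective `ι'`, where it becomes the relation for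
    -- `x* θ(m)`; each factor `e` costs one `d`.
    have hee : e * e = e := by
      apply E.ι'_injective
      apply smul_right_injective _ hd
      apply smul_right_injective _ hd
      change d • d • E.ι' (e * e) = d • d • E.ι' e
      rw [hι'e, ← X.isModule.idempotent, ← hι'e, map_mul, smul_mul_smul_comm, smul_smul]
    have hc (n) : e * (E.ι.comp X.β) n = (E.ι.comp X.β) n * e := by
      change e * E.ι (X.β n) = E.ι (X.β n) * e
      rw [he, smul_mul_assoc, mul_smul_comm, mul_assoc, ← map_mul,
        show X.m * X.β n = Q.θ (X.β n) * X.m from X.isModule.m_mem n, map_mul, E.θ_apply,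
        ← mul_assoc, E.star_v_mul, mul_assoc]
    have hem : E.ι' e * X.m = X.m := by
      apply smul_right_injective _ hd
      change d • _ = d • _
      rw [← smul_mul_assoc, hι'e, X.isModule.absorb]
    -- Were this product zero, `m β(q) = θβ(q) m` would vanish for `q = 1 - u u*`. Then `β(q) = 0`
    -- by `w* m = 1`, and `q = 0` as `β` is faithful, so `u` would be unitary.
    have hne : (E.ι.comp X.β) (1 - u * star u) * e ≠ 0 := by
      intro h
      have h1 : X.m * X.β (1 - u * star u) = 0 := by
        calc _ = Q.θ (X.β (1 - u * star u)) * X.m := X.isModule.m_mem _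
          _ = E.ι' ((E.ι.comp X.β) (1 - u * star u) * e) * X.m := by
            rw [map_mul, mul_assoc, hem, E.θ_apply]; rfl
          _ = 0 := by rw [h, map_zero, zero_mul]
      have h2 : X.β (1 - u * star u) = 0 := by
        rw [← one_mul (X.β (1 - u * star u)), ← mul_zero (star Q.w), ← h1, ← mul_assoc,
          X.isModule.unit]
      have h3 : 1 - u * star u = 0 :=
        (hC.finiteDim _ X.β_mem).injective (h2.trans (map_zero _).symm)
      exact hu1 (congrArg Subtype.val (sub_eq_zero.1 h3).symm)
    obtain ⟨V, hV, hVe, heV, hVc⟩ := hM.exists_isometry_of_idempotent (E.ι.comp X.β) hee hc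
      (Subtype.ext hu) hne
    exact E.exists_iso_of_isometry hC X hd hde hV hVe heV hVc

theorem mainTheorem4
    {H : Type*} [NormedAddCommGroup H] [InnerProductSpace ℂ H] [CompleteSpace H]
    [TopologicalSpace.SeparableSpace H]
    (N : VonNeumannAlgebra H) (hN : N.IsInfiniteFactor)
    (C : Set (N.Elt →⋆ₐ[ℂ] N.Elt)) (hC : IsTensorSubcategory C)
    (Q : QSystem C)
    {K : Type*} [NormedAddCommGroup K] [InnerProductSpace ℂ K] [CompleteSpace K]
    [TopologicalSpace.SeparableSpace K]
    (M : VonNeumannAlgebra K) (E : Q.Extension M.Elt)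
    -- the Q-system is simple
    (hM : M.IsFactor) :
    -- for every homomorphism `φ`, the pair `(ι' ∘ φ, x)` is a standard module
    (∀ φ : N.Elt →⋆ₐ[ℂ] M.Elt, Q.IsStandardModule (E.ι'.comp φ) Q.x) ∧
    -- the morphisms between these modules are exactly the `1_ι' × s`
    (∀ (φ φ' : N.Elt →⋆ₐ[ℂ] M.Elt) (t : N.Elt),
      Q.IsModuleHom (E.ι'.comp φ) Q.x (E.ι'.comp φ') Q.x t ↔
        ∃ s : M.Elt, IsIntertwiner φ φ' s ∧ t = E.ι' s) ∧
    -- `φ ↦ (ι' ∘ φ, x)`, `s ↦ 1_ι' × s` is an equivalence of categories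
    (∃ F : E.subHoms.FullSubcategory ⥤ Q.Mod, F.IsEquivalence ∧
      (∀ φ, (F.obj φ).β = E.ι'.comp φ.obj.toHom ∧ (F.obj φ).m = Q.x) ∧
      (∀ (φ φ' : E.subHoms.FullSubcategory) (s : φ ⟶ φ'), (F.map s).1 = E.ι' s.hom.1)) := by
  
  refine ⟨E.isStandardModule, E.isModuleHom_iff, E.toMod hC, ?_, fun φ => ⟨rfl, rfl⟩,
    fun φ φ' s => rfl⟩
  have := E.toMod_essSurj hN hC hM
  exact { }
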